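/- Let $G$ be a finite simple graph on $n$ vertices which is neither complete nor empty (i.e. $G$ has at least one edge and at least one pair of distinct non-adjacent vertices), and let $\overline{G}$ be its complement. Call $G$ representable in $\mathbb{R}^m$ if there are a map $p$ from the vertex set to $\mathbb{R}^m$ and distinct positive constants $\alpha \neq \beta$ such that, for all distinct vertices $u, v$, $\|p(u)-p(v)\| = \alpha$ if $u$ and $v$ are adjacent and $\|p(u)-p(v)\| = \beta$ otherwise; let $\mathrm{Rep}(G)$, the Euclidean representation number, be the smallest $m$ such that $G$ is representable in $\mathbb{R}^m$. (1) If $G$ (respectively $\overline{G}$) is a disjoint union of complete graphs, exactly $r$ of which have the maximal number of vertices, then \[ \mathrm{Rep}(G) = n - \max\{r, 2\}. \] (2) Suppose that neither $G$ nor $\overline{G}$ is a disjoint union of complete graphs. Let $m_1$ and $m_2$ be the multiplicities of the smallest and the second smallest distinct eigenvalues of the adjacency matrix of $G$, and let $\overline{m_1}$ and $\overline{m_2}$ be the corresponding multiplicities for $\overline{G}$. Then \[ n - 1 - \max\{m_1, \overline{m_1}, m_2+1, \overline{m_2}+1\} \;\le\; \mathrm{Rep}(G) \;\le\; n - \max\{m_1,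 \overline{m_1}, 2\}. \] If, in addition, $G$ is regular, then \[ \mathrm{Rep}(G) = n - 1 - \max\{m_1, \overline{m_1}\}. \] -/

import Mathlib

namespace SimpleGraph

/-- `G` is representable in `ℝ^m`: the vertices can be mapped to points of Euclidean `m`-space so
that distinct adjacent vertices are at distance `α` and distinct non-adjacent vertices are at
distance `β`, for some distinct positive constants `α` and `β`. (As `α, β > 0`, such a map is
automatically injective.) -/
def IsRepresentable {V : Type*} (G : SimpleGraph V) (m : ℕ) : Prop :=
  ∃ (p : V → EuclideanSpace ℝ (Fin m)) (α β : ℝ), 0 < α ∧ 0 < β ∧ α ≠ β ∧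
    (∀ u v, G.Adj u v → ‖p u - p v‖ = α) ∧
    (∀ u v, u ≠ v → ¬ G.Adj u v → ‖p u - p v‖ = β)

/-- The Euclidean representation number: the smallest `m` such that `G` is representable
in `ℝ^m`. -/
noncomputable def euclideanRep {V : Type*} (G : SimpleGraph V) : ℕ :=
  sInf {m : ℕ | G.IsRepresentable m}

/-- Every finite graph is representable in some dimension, so that the infimum in the definition
of `euclideanRep` is a minimum. -/
theorem exists_isRepresentable {V : Type*} [Fintype V] (G : SimpleGraph V) :
    ∃ m, G.IsRepresentable m := by
  classical
  set N : ℝ := (Fintype.card V : ℝ) + 1 with hN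
  let q : V → EuclideanSpace ℝ (V ⊕ G.edgeSet) := fun v =>
    WithLp.toLp 2 (Sum.elim (fun w => if w = v then Real.sqrt (N - G.degree v) else 0)
      (fun e => if v ∈ (e : Sym2 V) then 1 else 0))
  have hdeg : ∀ v, (0 : ℝ) ≤ N - G.degree v := by
    intro v
    have h : (G.degree v : ℝ) < Fintype.card V := by exact_mod_cast G.degree_lt_card_verts v
    rw [hN]; linarith
  have hself : ∀ v, inner ℝ (q v) (q v) = N := by
    intro v
    have h2 : (∑ e : G.edgeSet, if v ∈ (e : Sym2 V) then (1 : ℝ) else 0) = G.degree v := by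
      rw [← G.card_incidenceFinset_eq_degree v, Finset.sum_boole]
      congr 1
      refine Finset.card_bij (fun e _ => (e : Sym2 V)) ?_ ?_ ?_
      · intro e he
        simp only [Finset.mem_filter, Finset.mem_univ, true_and] at he
        simp [incidenceSet, he, e.2]
      · intro a _ b _ h
        exact Subtype.ext h
      · intro e he
        rw [mem_incidenceFinset] at he
        exact ⟨⟨e, he.1⟩, by simpa using he.2, rfl⟩
    simp only [q, PiLp.inner_apply, Fintype.sum_sum_type, Sum.elim_inl, Sum.elim_inr]
    simp [h2, Real.sq_sqrt (hdeg v)]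
  have hinner : ∀ u v, u ≠ v → inner ℝ (q u) (q v) = if G.Adj u v then (1 : ℝ) else 0 := by
    intro u v huv
    simp only [q, PiLp.inner_apply, Fintype.sum_sum_type, Sum.elim_inl, Sum.elim_inr]
    have h1 : ∀ w : V, inner ℝ (if w = u then Real.sqrt (N - G.degree u) else 0)
        (if w = v then Real.sqrt (N - G.degree v) else 0) = 0 := by
      intro w
      by_cases h : w = u
      · subst h; simp [huv]
      · simp [h]
    have h2 : ∀ e : G.edgeSet, inner ℝ (if u ∈ (e : Sym2 V) then (1 : ℝ) else 0)
        (if v ∈ (e : Sym2 V) then (1 : ℝ) else 0) = if (e : Sym2 V) = s(u, v) then 1 else 0 := by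
      intro e
      have := Sym2.mem_and_mem_iff (z := (e : Sym2 V)) huv
      by_cases hu : u ∈ (e : Sym2 V) <;> by_cases hv : v ∈ (e : Sym2 V) <;>
        simp [hu, hv, ← this]
    simp only [h1, h2, Finset.sum_const_zero, zero_add]
    by_cases hadj : G.Adj u v
    · rw [Finset.sum_eq_single (⟨s(u, v), hadj⟩ : G.edgeSet)]
      · simp [hadj]
      · intro b _ hb
        rw [if_neg (fun h => hb (Subtype.ext h))]
      · simp
    · rw [if_neg hadj]
      refine Finset.sum_eq_zero fun e _ => if_neg fun h => hadj ?_
      have := e.2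
      rwa [h] at this
  have hdist : ∀ u v, u ≠ v →
      ‖q u - q v‖ = Real.sqrt (2 * N - 2 * if G.Adj u v then (1 : ℝ) else 0) := by
    intro u v huv
    rw [← Real.sqrt_sq (norm_nonneg (q u - q v))]
    congr 1
    rw [@norm_sub_sq_real, ← real_inner_self_eq_norm_sq, ← real_inner_self_eq_norm_sq,
      hself, hself, hinner u v huv]
    ring
  rcases isEmpty_or_nonempty V with hV | hV
  · exact ⟨0, fun _ => 0, 1, 2, by norm_num, by norm_num, by norm_num,
      fun u => hV.elim u, fun u => hV.elim u⟩
  have hN2 : (2 : ℝ) ≤ N := by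
    have : (1 : ℝ) ≤ Fintype.card V := by exact_mod_cast Fintype.card_pos
    rw [hN]; linarith
  let f := (LinearIsometryEquiv.piLpCongrLeft 2 ℝ ℝ (Fintype.equivFin (V ⊕ G.edgeSet)))
  refine ⟨_, fun v => f (q v), Real.sqrt (2 * N - 2), Real.sqrt (2 * N),
    Real.sqrt_pos.2 (by linarith), Real.sqrt_pos.2 (by linarith), ?_, ?_, ?_⟩
  · exact (Real.sqrt_lt_sqrt (by linarith) (by linarith)).ne
  · intro u v h
    rw [← map_sub, LinearIsometryEquiv.norm_map, hdist u v h.ne, if_pos h, mul_one]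
  · intro u v huv h
    rw [← map_sub, LinearIsometryEquiv.norm_map, hdist u v huv, if_neg h, mul_zero, sub_zero]

/-- `G` is a disjoint union of complete graphs: every connected component is a clique. -/
def IsDisjointUnionOfCliques {V : Type*} (G : SimpleGraph V) : Prop :=
  ∀ c : G.ConnectedComponent, G.IsClique c.supp

/-- The number of connected components of `G` that have the largest number of vertices. -/
noncomputable def numLargestComponents {V : Type*} (G : SimpleGraph V) : ℕ :=
  Set.ncard {c : G.ConnectedComponent |
    ∀ c' : G.ConnectedComponent, c'.supp.ncard ≤ c.supp.ncard}

section Eigenvalues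

variable {V : Type*} [Fintype V] [DecidableEq V] (G : SimpleGraph V) [DecidableRel G.Adj]

/-- The set of (real) eigenvalues of the adjacency matrix of `G`. -/
def adjEigenvalues : Set ℝ :=
  {μ | Module.End.HasEigenvalue (Matrix.toLin' (G.adjMatrix ℝ)) μ}

/-- The multiplicity of `μ` as an eigenvalue of the (symmetric) adjacency matrix of `G`:
the dimension of the eigenspace. -/
noncomputable def adjMultiplicity (μ : ℝ) : ℕ :=
  Module.finrank ℝ (Module.End.eigenspace (Matrix.toLin' (G.adjMatrix ℝ)) μ)

/-- The smallest eigenvalue. -/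
noncomputable def smallestEigenvalue : ℝ :=
  sInf G.adjEigenvalues

/-- The second smallest distinct eigenvalue. -/
noncomputable def secondSmallestEigenvalue : ℝ :=
  sInf (G.adjEigenvalues \ {G.smallestEigenvalue})

/-- `m₁`, the multiplicity of the smallest eigenvalue. -/
noncomputable def smallestMult : ℕ := G.adjMultiplicity G.smallestEigenvalue

/-- `m₂`, the multiplicity of the second smallest distinct eigenvalue. -/
noncomputable def secondSmallestMult : ℕ := G.adjMultiplicity G.secondSmallestEigenvalue

theorem finite_adjEigenvalues : G.adjEigenvalues.Finite :=
  Module.End.finite_hasEigenvalue _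

theorem adjEigenvalues_nonempty [Nonempty V] : G.adjEigenvalues.Nonempty := by
  have hA : (G.adjMatrix ℝ).IsHermitian := by
    rw [Matrix.IsHermitian, Matrix.conjTranspose_eq_transpose_of_trivial, transpose_adjMatrix]
  obtain ⟨v⟩ := ‹Nonempty V›
  refine ⟨hA.eigenvalues v, ?_⟩
  have h := hA.eigenvalues_mem_spectrum_real v
  rw [← Matrix.spectrum_toLin'] at h
  exact Module.End.hasEigenvalue_iff_mem_spectrum.2 h

/-- For a nonempty vertex set, the infimum defining `smallestEigenvalue` is a minimum. -/
theorem isLeast_smallestEigenvalue [Nonempty V] :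
    IsLeast G.adjEigenvalues G.smallestEigenvalue :=
  ⟨G.adjEigenvalues_nonempty.csInf_mem G.finite_adjEigenvalues,
    fun _ h => csInf_le G.finite_adjEigenvalues.bddBelow h⟩

/-- If `G` has an edge, the infimum defining `secondSmallestEigenvalue` is a minimum. -/
theorem isLeast_secondSmallestEigenvalue (hG : G ≠ ⊥) :
    IsLeast (G.adjEigenvalues \ {G.smallestEigenvalue}) G.secondSmallestEigenvalue := by
  have hfin : (G.adjEigenvalues \ {G.smallestEigenvalue}).Finite :=
    G.finite_adjEigenvalues.subset Set.sdiff_subset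
  refine ⟨Set.Nonempty.csInf_mem ?_ hfin, fun _ h => csInf_le hfin.bddBelow h⟩
  by_contra hne
  rw [Set.not_nonempty_iff_eq_empty, Set.sdiff_eq_empty] at hne
  apply hG
  have hA : (G.adjMatrix ℝ).IsHermitian := by
    rw [Matrix.IsHermitian, Matrix.conjTranspose_eq_transpose_of_trivial, transpose_adjMatrix]
  have hev : ∀ v, hA.eigenvalues v = G.smallestEigenvalue := by
    intro v
    have h := hA.eigenvalues_mem_spectrum_real v
    rw [← Matrix.spectrum_toLin'] at h
    exact hne (Module.End.hasEigenvalue_iff_mem_spectrum.2 h)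
  have hscalar : G.adjMatrix ℝ = G.smallestEigenvalue • (1 : Matrix V V ℝ) := by
    have hd : Matrix.diagonal (RCLike.ofReal ∘ hA.eigenvalues : V → ℝ)
        = G.smallestEigenvalue • (1 : Matrix V V ℝ) := by
      rw [← Matrix.diagonal_one, ← Matrix.diagonal_smul]
      congr 1
      funext v
      simp [hev]
    have h := hA.spectral_theorem
    rw [hd] at h
    simpa using h
  ext u v
  simp only [bot_adj, iff_false]
  intro h
  have := congrFun (congrFun hscalar u) v
  simp [h, h.ne] at this

end Eigenvalues

end SimpleGraph

/-! Let `A` be the adjacency matrix and `n` the number of vertices. If `p` is a two-distance map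
with `α < β` and `x` has coordinate sum zero, then `2‖∑ x v • p v‖²` is `β² - α²` times the form of
`A + tI` at `x`, where `t = β² / (β² - α²) > 1`. So this form is nonnegative on sum-zero vectors,
and the points span an affine space of dimension `n - 1 - d`, with `d` the dimension of the kernel
of the compressed form. Conversely, a Gram factorization turns any such `t > 1` into a
representation. The case `β < α` is the same statement for the complement (`isRepresentable_iff`).

A nonnegative form has nonzero kernel only at the critical `t`, so `Rep(G)` is `n - 1` minus the
larger kernel dimension of `G` and `Gᶜ`, where a graph counts only if its critical value exceeds 1
(`euclideanRep_add_eq`, `euclideanRep_add_eq_of_le_one`). It does exceed 1 unless the graph is a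
union of cliques (`CenteredNonneg.one_lt`).

For a union of cliques, `A + I` is a block matrix of ones; only the complement counts, and its
kernel is read off from component sums (`IsDisjointUnionOfCliques.finrank_add_one_eq_max`).
Otherwise the kernel is compared with eigenspaces of `A`, each restriction to a hyperplane costing
at most one dimension (`IsCritical.smallestMult_le`, `IsCritical.finrank_le_max`). For regular
graphs the lowest eigenspace is already orthogonal to the constants, and nothing is lost. -/

namespace SimpleGraph

open Matrix

/-! ### The form of `A + tI` on sum-zero vectors -/

section Centered

variable {V : Type*} [Fintype V] (G : SimpleGraph V) [DecidableRel G.Adj]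

/-- The quadratic form of `A + t I`, where `A` is the adjacency matrix of `G`. -/
noncomputable def shiftedForm (t : ℝ) (x : V → ℝ) : ℝ :=
  x ⬝ᵥ (G.adjMatrix ℝ *ᵥ x) + t * (x ⬝ᵥ x)

/-- The form of `A + t I` is positive semidefinite on the vectors with coordinate sum zero. -/
def CenteredNonneg (t : ℝ) : Prop :=
  ∀ x : V → ℝ, ∑ v, x v = 0 → 0 ≤ G.shiftedForm t x

/-- The kernel of the compression of `A + t I` to the vectors with coordinate sum zero. -/
noncomputable def centeredKernel (t : ℝ) : Submodule ℝ (V → ℝ) where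
  carrier := {x | ∑ v, x v = 0 ∧
    ∀ u v, (G.adjMatrix ℝ *ᵥ x) u + t * x u = (G.adjMatrix ℝ *ᵥ x) v + t * x v}
  add_mem' := by
    rintro x y ⟨hx, hx'⟩ ⟨hy, hy'⟩
    refine ⟨by simp [Finset.sum_add_distrib, hx, hy], fun u v => ?_⟩
    simp only [mulVec_add, Pi.add_apply]
    linarith [hx' u v, hy' u v]
  zero_mem' := by simp
  smul_mem' := by
    rintro c x ⟨hx, hx'⟩
    refine ⟨by simp [← Finset.mul_sum, hx], fun u v => ?_⟩
    simp only [mulVec_smul, Pi.smul_apply, smul_eq_mul]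
    linear_combination c * hx' u v

/-- `-t` is the smallest eigenvalue of the compression of the adjacency matrix to the vectors with
coordinate sum zero. -/
def IsCritical (t : ℝ) : Prop :=
  G.CenteredNonneg t ∧ G.centeredKernel t ≠ ⊥

variable {G} {t s : ℝ} {x y : V → ℝ}

theorem mem_centeredKernel : x ∈ G.centeredKernel t ↔ ∑ v, x v = 0 ∧
    ∀ u v, (G.adjMatrix ℝ *ᵥ x) u + t * x u = (G.adjMatrix ℝ *ᵥ x) v + t * x v :=
  Iff.rfl

theorem mulVec_adjMatrix_dotProduct_comm (x y : V → ℝ) :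
    x ⬝ᵥ (G.adjMatrix ℝ *ᵥ y) = y ⬝ᵥ (G.adjMatrix ℝ *ᵥ x) := by
  rw [dotProduct_mulVec, ← mulVec_transpose, transpose_adjMatrix, dotProduct_comm]

theorem shiftedForm_add_smul (x y : V → ℝ) (c : ℝ) :
    G.shiftedForm t (x + c • y) = G.shiftedForm t x +
      2 * c * (y ⬝ᵥ (G.adjMatrix ℝ *ᵥ x + t • x)) + c ^ 2 * G.shiftedForm t y := by
  simp only [shiftedForm, mulVec_add, mulVec_smul, add_dotProduct, dotProduct_add, smul_dotProduct,
    dotProduct_smul, smul_eq_mul]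
  rw [mulVec_adjMatrix_dotProduct_comm x y, dotProduct_comm x y]
  ring

theorem shiftedForm_eq_add (t s : ℝ) (x : V → ℝ) :
    G.shiftedForm t x = G.shiftedForm s x + (t - s) * (x ⬝ᵥ x) := by
  simp only [shiftedForm]; ring

theorem shiftedForm_eq_zero_of_mem (hx : x ∈ G.centeredKernel t) : G.shiftedForm t x = 0 := by
  rcases isEmpty_or_nonempty V with hV | ⟨⟨w⟩⟩
  · simp [shiftedForm, dotProduct]
  have h : G.shiftedForm t x = ∑ v, x v * ((G.adjMatrix ℝ *ᵥ x) v + t * x v) := by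
    simp only [shiftedForm, dotProduct, Finset.mul_sum, ← Finset.sum_add_distrib]
    exact Finset.sum_congr rfl fun v _ => by ring
  rw [h, Finset.sum_congr rfl fun v _ => by rw [hx.2 v w], ← Finset.sum_mul, hx.1, zero_mul]

/-- Along the line `x + c(e_u - e_v)` the form is a nonnegative quadratic in `c` with zero constant
term, so its linear coefficient vanishes. -/
theorem CenteredNonneg.mem_centeredKernel (h : G.CenteredNonneg t) (hx : ∑ v, x v = 0)
    (hx0 : G.shiftedForm t x = 0) : x ∈ G.centeredKernel t := by
  classical
  refine ⟨hx, fun u v => ?_⟩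
  set y : V → ℝ := Pi.single u 1 - Pi.single v 1 with hy
  have hsum : ∑ w, y w = 0 := by simp [hy]
  have key : ∀ c : ℝ, 0 ≤ G.shiftedForm t y * (c * c) +
      (2 * (y ⬝ᵥ (G.adjMatrix ℝ *ᵥ x + t • x))) * c + 0 := by
    intro c
    have := h (x + c • y) (by simp [Finset.sum_add_distrib, ← Finset.mul_sum, hx, hsum])
    rw [shiftedForm_add_smul, hx0] at this
    linarith
  have hd := discrim_le_zero key
  rw [discrim] at hd
  have h0 : y ⬝ᵥ (G.adjMatrix ℝ *ᵥ x + t • x) = 0 := by nlinarith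
  rw [hy, sub_dotProduct, single_one_dotProduct, single_one_dotProduct] at h0
  simp only [Pi.add_apply, Pi.smul_apply, smul_eq_mul] at h0
  linarith

theorem mem_centeredKernel_of_mulVec_eq {μ : ℝ} (hx : ∑ v, x v = 0)
    (h : G.adjMatrix ℝ *ᵥ x = μ • x) :
    x ∈ G.centeredKernel (-μ) :=
  ⟨hx, fun u v => by rw [h]; simp⟩

theorem dotProduct_self_pos (hx : x ≠ 0) : 0 < x ⬝ᵥ x := by
  simpa using dotProduct_star_self_pos_iff.2 hx

/-- On a kernel vector at `t`, the form at `s` equals `(s - t)‖x‖²`. -/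
theorem IsCritical.le_of_centeredNonneg (ht : G.IsCritical t) (hs : G.CenteredNonneg s) :
    t ≤ s := by
  obtain ⟨x, hx, hx0⟩ := Submodule.exists_mem_ne_zero_of_ne_bot ht.2
  have h1 := hs x hx.1
  rw [shiftedForm_eq_add s t, shiftedForm_eq_zero_of_mem hx] at h1
  nlinarith [dotProduct_self_pos hx0]

theorem IsCritical.eq (ht : G.IsCritical t) (hs : G.IsCritical s) : t = s :=
  le_antisymm (ht.le_of_centeredNonneg hs.1) (hs.le_of_centeredNonneg ht.1)

/-- The critical value is minus the minimum of the form of `A` over the compact unit sphere of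
sum-zero vectors, and a minimizer spans part of the kernel. -/
theorem exists_isCritical [Nontrivial V] (G : SimpleGraph V) [DecidableRel G.Adj] :
    ∃ t, G.IsCritical t := by
  classical
  let S : Set (V → ℝ) := {x | ∑ v, x v = 0 ∧ x ⬝ᵥ x = 1}
  have hbdd : S ⊆ Set.Icc (fun _ => -1) (fun _ => 1) := by
    rintro x ⟨-, hx⟩
    have : ∀ v, x v ^ 2 ≤ 1 := by
      intro v
      rw [← hx, dotProduct, sq]
      exact Finset.single_le_sum (f := fun v => x v * x v) (fun i _ => mul_self_nonneg _)
        (Finset.mem_univ v)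
    exact ⟨fun v => (abs_le_one_iff_mul_self_le_one.2 (by nlinarith [this v]) |> abs_le.1).1,
      fun v => (abs_le_one_iff_mul_self_le_one.2 (by nlinarith [this v]) |> abs_le.1).2⟩
  have hclosed : IsClosed S := by
    refine IsClosed.inter (isClosed_eq (by fun_prop) continuous_const)
      (isClosed_eq ?_ continuous_const)
    simp only [dotProduct]; fun_prop
  have hcomp : IsCompact S := isCompact_Icc.of_isClosed_subset hclosed hbdd
  have hscale : ∀ y : V → ℝ, ∑ v, y v = 0 → y ≠ 0 → (Real.sqrt (y ⬝ᵥ y))⁻¹ • y ∈ S := by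
    intro y hy hy0
    have hpos := dotProduct_self_pos hy0
    refine ⟨by simp [← Finset.mul_sum, hy], ?_⟩
    simp only [smul_dotProduct, dotProduct_smul, smul_eq_mul]
    have := Real.mul_self_sqrt hpos.le
    have h2 := Real.sqrt_pos.2 hpos
    field_simp
    nlinarith
  have hne : S.Nonempty := by
    obtain ⟨u, v, huv⟩ := exists_pair_ne V
    refine ⟨_, hscale (Pi.single u 1 - Pi.single v 1) (by simp) fun h => ?_⟩
    have := congrFun h u
    simp [huv] at this
  obtain ⟨x, hx, hmin⟩ := hcomp.exists_isMinOn hne (f := fun x => x ⬝ᵥ (G.adjMatrix ℝ *ᵥ x)) (by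
    simp only [dotProduct, mulVec]; fun_prop)
  set t := -(x ⬝ᵥ (G.adjMatrix ℝ *ᵥ x)) with ht
  have hnn : G.CenteredNonneg t := by
    intro y hy
    by_cases hy0 : y = 0
    · simp [shiftedForm, hy0]
    have hpos := dotProduct_self_pos hy0
    have h1 : x ⬝ᵥ (G.adjMatrix ℝ *ᵥ x) ≤ _ := hmin (hscale y hy hy0)
    have h2 := Real.mul_self_sqrt hpos.le
    have h3 := Real.sqrt_pos.2 hpos
    simp only [mulVec_smul, smul_dotProduct, dotProduct_smul, smul_eq_mul] at h1
    rw [← mul_assoc, ← mul_inv, h2, ← div_eq_inv_mul, le_div_iff₀ hpos] at h1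
    simp only [shiftedForm, ht]
    linarith
  refine ⟨t, hnn, fun hbot => ?_⟩
  have hmem := hnn.mem_centeredKernel hx.1 (by simp [shiftedForm, hx.2, ht])
  rw [hbot, Submodule.mem_bot] at hmem
  have := hx.2
  simp [hmem] at this

/-- The two adjacency matrices and the identity add up to the all-ones matrix, which kills sum-zero
vectors. -/
theorem adjMatrix_compl_mulVec [DecidableEq V] (hx : ∑ v, x v = 0) :
    Gᶜ.adjMatrix ℝ *ᵥ x = -x - G.adjMatrix ℝ *ᵥ x := by
  have h := G.one_add_adjMatrix_add_compl_adjMatrix_eq_of_one (α := ℝ)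
  rw [compl_adjMatrix_eq_adjMatrix_compl] at h
  have h2 := congrArg (· *ᵥ x) h
  simp only [add_mulVec, one_mulVec] at h2
  have h3 : (Matrix.of 1 : Matrix V V ℝ) *ᵥ x = 0 := by
    ext v
    simp [mulVec, dotProduct, hx]
  rw [h3] at h2
  linear_combination (exp := 1) h2

end Centered

/-! ### Two-distance maps versus nonnegative centered forms -/

section Representations

theorem IsRepresentable.compl {V : Type*} {G : SimpleGraph V} {m : ℕ} (h : G.IsRepresentable m) :
    Gᶜ.IsRepresentable m := by
  obtain ⟨p, α, β, hα, hβ, hne, h1, h2⟩ := h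
  refine ⟨p, β, α, hβ, hα, hne.symm, fun u v h => ?_, fun u v huv h => ?_⟩
  · rw [compl_adj] at h
    exact h2 u v h.1 h.2
  · rw [compl_adj, not_and, not_not] at h
    exact h1 u v (h huv)

theorem isRepresentable_compl {V : Type*} {G : SimpleGraph V} {m : ℕ} :
    Gᶜ.IsRepresentable m ↔ G.IsRepresentable m :=
  ⟨fun h => by simpa using h.compl, fun h => h.compl⟩

theorem euclideanRep_compl {V : Type*} (G : SimpleGraph V) :
    Gᶜ.euclideanRep = G.euclideanRep := by
  simp only [euclideanRep, isRepresentable_compl]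

variable {V : Type*} [Fintype V] {G : SimpleGraph V} [DecidableRel G.Adj]

/-- The matrix of squared distances is `β²(J - I) - (β² - α²)A` with `J` all ones, and `J`
contributes nothing when the coordinates sum to zero. -/
theorem norm_sq_sum_smul_of_two_distances {E : Type*} [NormedAddCommGroup E]
    [InnerProductSpace ℝ E] {p : V → E} {α β : ℝ}
    (hα : ∀ u v, G.Adj u v → ‖p u - p v‖ = α)
    (hβ : ∀ u v, u ≠ v → ¬ G.Adj u v → ‖p u - p v‖ = β) {x : V → ℝ} (hx : ∑ v, x v = 0) :
    2 * ‖∑ v, x v • p v‖ ^ 2 =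
      (β ^ 2 - α ^ 2) * (x ⬝ᵥ (G.adjMatrix ℝ *ᵥ x)) + β ^ 2 * (x ⬝ᵥ x) := by
  classical
  have hd : ∀ u v, ‖p u - p v‖ * ‖p u - p v‖ =
      β ^ 2 - (β ^ 2 - α ^ 2) * G.adjMatrix ℝ u v - β ^ 2 * if u = v then 1 else 0 := by
    intro u v
    by_cases huv : u = v
    · simp [huv]
    · by_cases h : G.Adj u v
      · simp [hα u v h, h, huv]; ring
      · simp [hβ u v huv h, h, huv]; ring
  rw [← real_inner_self_eq_norm_sq, inner_sum_smul_sum_smul_of_sum_eq_zero p hx p hx]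
  have hsum : ∑ u, ∑ v, x u * x v * (‖p u - p v‖ * ‖p u - p v‖) =
      β ^ 2 * ((∑ u, x u) * ∑ v, x v) - (β ^ 2 - α ^ 2) * (x ⬝ᵥ (G.adjMatrix ℝ *ᵥ x))
        - β ^ 2 * (x ⬝ᵥ x) := by
    have hdiag : x ⬝ᵥ x = ∑ u, ∑ v, x u * x v * if u = v then 1 else 0 := by
      simp [dotProduct]
    rw [hdiag, Finset.sum_mul_sum]
    simp only [dotProduct, mulVec, Finset.mul_sum, ← Finset.sum_sub_distrib, hd]
    exact Finset.sum_congr rfl fun u _ => Finset.sum_congr rfl fun v _ => by ring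
  rw [hsum, hx]
  ring

theorem exists_centeredNonneg_of_two_distances {m : ℕ} {p : V → EuclideanSpace ℝ (Fin m)} {α β : ℝ}
    (hα0 : 0 < α) (hαβ : α < β)
    (hα : ∀ u v, G.Adj u v → ‖p u - p v‖ = α)
    (hβ : ∀ u v, u ≠ v → ¬ G.Adj u v → ‖p u - p v‖ = β) :
    ∃ t, 1 < t ∧ G.CenteredNonneg t ∧
      Fintype.card V ≤ m + 1 + Module.finrank ℝ (G.centeredKernel t) := by
  have hpos : 0 < β ^ 2 - α ^ 2 := by nlinarith
  set t := β ^ 2 / (β ^ 2 - α ^ 2) with ht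
  have hmul : (β ^ 2 - α ^ 2) * t = β ^ 2 := by rw [ht]; field_simp
  have hform : ∀ x : V → ℝ, ∑ v, x v = 0 →
      2 * ‖∑ v, x v • p v‖ ^ 2 = (β ^ 2 - α ^ 2) * G.shiftedForm t x := by
    intro x hx
    rw [norm_sq_sum_smul_of_two_distances hα hβ hx, shiftedForm, mul_add, ← mul_assoc, hmul]
  have hnn : G.CenteredNonneg t := by
    intro x hx
    have h := hform x hx
    by_contra hneg
    nlinarith [sq_nonneg ‖∑ v, x v • p v‖, mul_neg_of_pos_of_neg hpos (not_le.1 hneg)]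
  refine ⟨t, ?_, hnn, ?_⟩
  · rw [ht, lt_div_iff₀ hpos]; nlinarith
  -- The kernel of `T` consists of the affine dependencies of the points; the extra coordinate is
  -- the `1` in `m + 1`.
  let T : (V → ℝ) →ₗ[ℝ] EuclideanSpace ℝ (Fin m) × ℝ :=
    (Fintype.linearCombination ℝ p).prod (Fintype.linearCombination ℝ (fun _ => (1 : ℝ)))
  have hker : T.ker ≤ G.centeredKernel t := by
    intro x hx
    have h1 : ∑ v, x v • p v = 0 := congrArg Prod.fst (LinearMap.mem_ker.1 hx)
    have h2 : ∑ v, x v • (1 : ℝ) = 0 := congrArg Prod.snd (LinearMap.mem_ker.1 hx)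
    simp only [smul_eq_mul, mul_one] at h2
    refine hnn.mem_centeredKernel h2 ?_
    have h := hform x h2
    rw [h1] at h
    simpa [hpos.ne'] using h
  have h1 := T.finrank_range_add_finrank_ker
  have h2 := Submodule.finrank_mono hker
  have h3 := Submodule.finrank_le T.range
  simp only [Module.finrank_prod, finrank_euclideanSpace, Fintype.card_fin, Module.finrank_self,
    Module.finrank_fintype_fun_eq_card] at h1 h3
  omega

/-- The orthogonal projection onto the vectors with coordinate sum zero. -/
noncomputable def centering (V : Type*) [Fintype V] [DecidableEq V] : Matrix V V ℝ :=
  1 - (Fintype.card V : ℝ)⁻¹ • Matrix.of 1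

theorem centering_transpose [DecidableEq V] : (centering V)ᵀ = centering V := by
  ext u v
  simp [centering, Matrix.one_apply, eq_comm]

theorem centering_mulVec_apply [DecidableEq V] (x : V → ℝ) (v : V) :
    (centering V *ᵥ x) v = x v - (Fintype.card V : ℝ)⁻¹ * ∑ w, x w := by
  have h : ((Matrix.of 1 : Matrix V V ℝ) *ᵥ x) v = ∑ w, x w := by simp [mulVec, dotProduct]
  rw [centering, sub_mulVec, smul_mulVec, one_mulVec, Pi.sub_apply, Pi.smul_apply, h, smul_eq_mul]

theorem centering_mulVec_of_sum_eq_zero [DecidableEq V] {x : V → ℝ} (hx : ∑ v, x v = 0) :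
    centering V *ᵥ x = x := by
  ext v; simp [centering_mulVec_apply, hx]

theorem sum_centering_mulVec [DecidableEq V] (x : V → ℝ) : ∑ v, (centering V *ᵥ x) v = 0 := by
  rcases isEmpty_or_nonempty V with hV | hV
  · simp
  · simp [centering_mulVec_apply, Finset.sum_sub_distrib]

theorem centering_mulVec_const [DecidableEq V] {x : V → ℝ} (hx : ∀ u v, x u = x v) :
    centering V *ᵥ x = 0 := by
  ext v
  have : Nonempty V := ⟨v⟩
  rw [centering_mulVec_apply, Finset.sum_congr rfl fun u _ => hx u v]
  simp

-- Conjugating `A + tI` by the centering projection gives a positive semidefinite matrix, hence one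
-- of the form `CᵀC`, and `T` is `C`. Its kernel contains the constants and the centered kernel,
-- which meet trivially; this gives the rank bound.
open scoped MatrixOrder in
theorem exists_linearMap_of_centeredNonneg {t : ℝ} (h : G.CenteredNonneg t) [Nonempty V] :
    ∃ T : (V → ℝ) →ₗ[ℝ] EuclideanSpace ℝ V,
      (∀ x, ∑ v, x v = 0 → ‖T x‖ ^ 2 = G.shiftedForm t x) ∧
      Module.finrank ℝ T.range + 1 + Module.finrank ℝ (G.centeredKernel t) ≤ Fintype.card V := by
  classical
  set B : Matrix V V ℝ := G.adjMatrix ℝ + t • 1 with hB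
  set M : Matrix V V ℝ := centering V * B * centering V with hM
  have hBform : ∀ x, x ⬝ᵥ (B *ᵥ x) = G.shiftedForm t x := by
    intro x
    simp [hB, shiftedForm, add_mulVec, dotProduct_add, smul_mulVec]
  have hMform : ∀ x, x ⬝ᵥ (M *ᵥ x) = G.shiftedForm t (centering V *ᵥ x) := by
    intro x
    rw [hM, mul_assoc, ← mulVec_mulVec, ← mulVec_mulVec, dotProduct_mulVec, ← mulVec_transpose,
      centering_transpose, hBform]
  have hherm : M.IsHermitian := by
    rw [IsHermitian, conjTranspose_eq_transpose_of_trivial, hM]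
    simp [transpose_mul, centering_transpose, hB, mul_assoc]
  have hpsd : M.PosSemidef := PosSemidef.of_dotProduct_mulVec_nonneg hherm fun x => by
    simpa [hMform] using h _ (sum_centering_mulVec x)
  obtain ⟨C, hC⟩ := CStarAlgebra.nonneg_iff_eq_star_mul_self.mp hpsd.nonneg
  let T : (V → ℝ) →ₗ[ℝ] EuclideanSpace ℝ V :=
    (WithLp.linearEquiv 2 ℝ (V → ℝ)).symm.toLinearMap ∘ₗ C.mulVecLin
  have hTnorm : ∀ x, ‖T x‖ ^ 2 = G.shiftedForm t (centering V *ᵥ x) := by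
    intro x
    have h1 : ‖T x‖ ^ 2 = (C *ᵥ x) ⬝ᵥ (C *ᵥ x) := by
      rw [EuclideanSpace.norm_sq_eq]
      simp [T, dotProduct, sq]
    rw [h1, ← hMform, hC, ← mulVec_mulVec, dotProduct_mulVec x, star_eq_conjTranspose,
      conjTranspose_eq_transpose_of_trivial, vecMul_transpose]
  refine ⟨T, fun x hx => by rw [hTnorm, centering_mulVec_of_sum_eq_zero hx], ?_⟩
  have hle : Submodule.span ℝ {(1 : V → ℝ)} ⊔ G.centeredKernel t ≤ T.ker := by
    refine sup_le ?_ fun x hx => ?_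
    · rw [Submodule.span_singleton_le_iff_mem, LinearMap.mem_ker, ← norm_eq_zero,
        ← sq_eq_zero_iff, hTnorm, centering_mulVec_const (fun _ _ => rfl)]
      simp [shiftedForm]
    · rw [LinearMap.mem_ker, ← norm_eq_zero, ← sq_eq_zero_iff, hTnorm,
        centering_mulVec_of_sum_eq_zero hx.1, shiftedForm_eq_zero_of_mem hx]
  have hinf : Submodule.span ℝ {(1 : V → ℝ)} ⊓ G.centeredKernel t = ⊥ := by
    rw [Submodule.eq_bot_iff]
    rintro x ⟨hx1, hx2⟩
    obtain ⟨c, rfl⟩ := Submodule.mem_span_singleton.1 hx1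
    have := hx2.1
    simp at this
    simp [this]
  have h1 := T.finrank_range_add_finrank_ker
  have h2 := Submodule.finrank_mono hle
  have h3 := Submodule.finrank_sup_add_finrank_inf_eq (Submodule.span ℝ {(1 : V → ℝ)})
    (G.centeredKernel t)
  rw [hinf, finrank_bot, finrank_span_singleton one_ne_zero] at h3
  rw [Module.finrank_fintype_fun_eq_card] at h1
  omega

theorem nonempty_linearIsometry_of_finrank_le {E F : Type*} [NormedAddCommGroup E]
    [InnerProductSpace ℝ E] [FiniteDimensional ℝ E] [NormedAddCommGroup F] [InnerProductSpace ℝ F]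
    [FiniteDimensional ℝ F] (h : Module.finrank ℝ E ≤ Module.finrank ℝ F) :
    Nonempty (E →ₗᵢ[ℝ] F) := by
  let b := stdOrthonormalBasis ℝ E
  let c := stdOrthonormalBasis ℝ F
  refine ⟨(b.toBasis.constr ℝ (c ∘ Fin.castLE h)).isometryOfOrthonormal (v := b.toBasis)
    (by simp) ?_⟩
  have : b.toBasis.constr ℝ (c ∘ Fin.castLE h) ∘ b.toBasis = c ∘ Fin.castLE h :=
    funext fun i => b.toBasis.constr_basis ℝ _ i
  rw [this]
  exact c.orthonormal.comp _ (Fin.castLE_injective h)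

/-- Vertices go to the images of the basis vectors under the Gram factor. Since `e_u - e_v` is
centered, the squared distances are `2t - 2` and `2t`; the condition `1 < t` makes the first
positive. -/
theorem isRepresentable_of_centeredNonneg {t : ℝ} (ht : 1 < t) (h : G.CenteredNonneg t)
    {m : ℕ} (hm : Fintype.card V ≤ m + 1 + Module.finrank ℝ (G.centeredKernel t)) :
    G.IsRepresentable m := by
  classical
  rcases isEmpty_or_nonempty V with hV | hV
  · exact ⟨fun _ => 0, 1, 2, by norm_num, by norm_num, by norm_num,
      fun u => hV.elim u, fun u => hV.elim u⟩
  obtain ⟨T, hT, hrank⟩ := exists_linearMap_of_centeredNonneg h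
  have hle : Module.finrank ℝ T.range ≤ Module.finrank ℝ (EuclideanSpace ℝ (Fin m)) := by
    rw [finrank_euclideanSpace_fin]; omega
  obtain ⟨φ⟩ := nonempty_linearIsometry_of_finrank_le hle
  have hdist : ∀ u v, u ≠ v →
      ‖φ (T.rangeRestrict (Pi.single u 1)) - φ (T.rangeRestrict (Pi.single v 1))‖ =
        Real.sqrt (2 * t - 2 * G.adjMatrix ℝ u v) := by
    intro u v huv
    rw [← map_sub, ← map_sub, φ.norm_map, ← Real.sqrt_sq (norm_nonneg _)]
    congr 1
    change ‖T _‖ ^ 2 = _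
    rw [hT _ (by simp), shiftedForm]
    have hvu : G.adjMatrix ℝ v u = G.adjMatrix ℝ u v := by simp [adj_comm]
    simp only [mulVec_sub, sub_dotProduct, dotProduct_sub, single_one_dotProduct, mulVec_single_one,
      col_apply, hvu]
    simp only [Pi.single_eq_same, Pi.single_eq_of_ne huv, Pi.single_eq_of_ne huv.symm,
      adjMatrix_apply, SimpleGraph.irrefl, if_false]
    ring
  refine ⟨fun v => φ (T.rangeRestrict (Pi.single v 1)), Real.sqrt (2 * t - 2), Real.sqrt (2 * t),
    Real.sqrt_pos.2 (by linarith), Real.sqrt_pos.2 (by linarith),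
    (Real.sqrt_lt_sqrt (by linarith) (by linarith)).ne, fun u v huv => ?_, fun u v huv hadj => ?_⟩
  · rw [hdist u v huv.ne]; simp [huv]
  · rw [hdist u v huv]; simp [hadj]

/-- The two alternatives correspond to `α < β` and `β < α`. -/
theorem isRepresentable_iff [DecidableEq V] {m : ℕ} : G.IsRepresentable m ↔
    (∃ t, 1 < t ∧ G.CenteredNonneg t ∧
      Fintype.card V ≤ m + 1 + Module.finrank ℝ (G.centeredKernel t)) ∨
    (∃ t, 1 < t ∧ Gᶜ.CenteredNonneg t ∧
      Fintype.card V ≤ m + 1 + Module.finrank ℝ (Gᶜ.centeredKernel t)) := by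
  constructor
  · rintro ⟨p, α, β, hα0, hβ0, hne, hα, hβ⟩
    rcases hne.lt_or_gt with hlt | hlt
    · exact Or.inl (exists_centeredNonneg_of_two_distances hα0 hlt hα hβ)
    · refine Or.inr (exists_centeredNonneg_of_two_distances (p := p) hβ0 hlt
        (fun u v h => ?_) fun u v huv h => ?_)
      · rw [compl_adj] at h
        exact hβ u v h.1 h.2
      · rw [compl_adj, not_and, not_not] at h
        exact hα u v (h huv)
  · rintro (⟨t, ht, hnn, hm⟩ | ⟨t, ht, hnn, hm⟩)
    · exact isRepresentable_of_centeredNonneg ht hnn hm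
    · exact isRepresentable_compl.1 (isRepresentable_of_centeredNonneg ht hnn hm)

end Representations

/-! ### The representation number from the critical values -/

section CriticalValue

variable {V : Type*} [Fintype V] {G : SimpleGraph V} [DecidableRel G.Adj] {s t : ℝ}

theorem finrank_centeredKernel_add_one_le [Nonempty V] (h : G.CenteredNonneg t) :
    Module.finrank ℝ (G.centeredKernel t) + 1 ≤ Fintype.card V := by
  obtain ⟨T, -, hT⟩ := exists_linearMap_of_centeredNonneg h
  omega

theorem IsCritical.finrank_pos (h : G.IsCritical t) :
    0 < Module.finrank ℝ (G.centeredKernel t) :=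
  Module.finrank_pos_iff.2 (Submodule.nontrivial_iff_ne_bot.2 h.2)

theorem IsCritical.finrank_eq_zero_of_lt (ht : G.IsCritical t) (hs : G.CenteredNonneg s)
    (h : t < s) : Module.finrank ℝ (G.centeredKernel s) = 0 := by
  by_contra hne
  refine h.ne (ht.eq ⟨hs, fun hbot => hne ?_⟩)
  rw [hbot, finrank_bot]

theorem IsCritical.finrank_le (ht : G.IsCritical t) (hs : G.CenteredNonneg s) :
    Module.finrank ℝ (G.centeredKernel s) ≤ Module.finrank ℝ (G.centeredKernel t) := by
  rcases (ht.le_of_centeredNonneg hs).eq_or_lt with rfl | h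
  · exact le_rfl
  · rw [ht.finrank_eq_zero_of_lt hs h]; exact Nat.zero_le _

theorem euclideanRep_add_eq [DecidableEq V] [Nonempty V] (hs : G.IsCritical s)
    (ht : Gᶜ.IsCritical t) (hs1 : 1 < s) (ht1 : 1 < t) :
    G.euclideanRep + (max (Module.finrank ℝ (G.centeredKernel s))
      (Module.finrank ℝ (Gᶜ.centeredKernel t)) + 1) = Fintype.card V := by
  have hiff : ∀ m, G.IsRepresentable m ↔ Fintype.card V ≤ m +
      (max (Module.finrank ℝ (G.centeredKernel s)) (Module.finrank ℝ (Gᶜ.centeredKernel t)) + 1) := by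
    intro m
    rw [isRepresentable_iff]
    constructor
    · rintro (⟨r, -, hr, hm⟩ | ⟨r, -, hr, hm⟩)
      · have := hs.finrank_le hr; omega
      · have := ht.finrank_le hr; omega
    · intro hm
      rcases max_choice (Module.finrank ℝ (G.centeredKernel s))
        (Module.finrank ℝ (Gᶜ.centeredKernel t)) with h | h <;> rw [h] at hm
      · exact Or.inl ⟨s, hs1, hs.1, by omega⟩
      · exact Or.inr ⟨t, ht1, ht.1, by omega⟩
  have h1 := (hiff _).1 (Nat.sInf_mem (s := {m | G.IsRepresentable m}) G.exists_isRepresentable)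
  -- These bounds keep the natural-number subtraction below from truncating.
  have hle := finrank_centeredKernel_add_one_le hs.1
  have hle' := finrank_centeredKernel_add_one_le ht.1
  have h2 : G.euclideanRep ≤ _ := Nat.sInf_le ((hiff (Fintype.card V -
    (max (Module.finrank ℝ (G.centeredKernel s)) (Module.finrank ℝ (Gᶜ.centeredKernel t)) + 1))).2
      (by omega))
  change _ ≤ G.euclideanRep + _ at h1
  omega

/-- Every admissible parameter for `G` is above 1, hence above `s`, and has zero kernel; so `G`
itself never beats its complement. -/
theorem euclideanRep_add_eq_of_le_one [DecidableEq V] [Nonempty V] (hs : G.IsCritical s)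
    (ht : Gᶜ.IsCritical t) (hs1 : s ≤ 1) (ht1 : 1 < t) :
    G.euclideanRep + (Module.finrank ℝ (Gᶜ.centeredKernel t) + 1) = Fintype.card V := by
  have hiff : ∀ m, G.IsRepresentable m ↔ Fintype.card V ≤ m +
      (Module.finrank ℝ (Gᶜ.centeredKernel t) + 1) := by
    intro m
    rw [isRepresentable_iff]
    constructor
    · rintro (⟨r, hr1, hr, hm⟩ | ⟨r, -, hr, hm⟩)
      · have := hs.finrank_eq_zero_of_lt hr (by linarith); omega
      · have := ht.finrank_le hr; omega
    · exact fun hm => Or.inr ⟨t, ht1, ht.1, by omega⟩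
  have h1 := (hiff _).1 (Nat.sInf_mem (s := {m | G.IsRepresentable m}) G.exists_isRepresentable)
  have hle := finrank_centeredKernel_add_one_le ht.1
  have h2 : G.euclideanRep ≤ _ := Nat.sInf_le ((hiff (Fintype.card V -
    (Module.finrank ℝ (Gᶜ.centeredKernel t) + 1))).2 (by omega))
  change _ ≤ G.euclideanRep + _ at h1
  omega

end CriticalValue

/-! ### Disjoint unions of complete graphs -/

section DisjointUnionOfCliques

theorem isDisjointUnionOfCliques_iff {V : Type*} {G : SimpleGraph V} :
    G.IsDisjointUnionOfCliques ↔ ∀ u v, G.Reachable u v → u ≠ v → G.Adj u v := by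
  constructor
  · intro h u v huv hne
    exact h (G.connectedComponentMk u) rfl (ConnectedComponent.sound huv.symm) hne
  · intro h c u hu v hv hne
    rw [ConnectedComponent.mem_supp_iff] at hu hv
    exact h u v (ConnectedComponent.exact (hu.trans hv.symm)) hne

theorem IsDisjointUnionOfCliques.adj_iff {V : Type*} {G : SimpleGraph V}
    (h : G.IsDisjointUnionOfCliques) {u v : V} :
    G.Adj u v ↔ u ≠ v ∧ G.connectedComponentMk u = G.connectedComponentMk v :=
  ⟨fun huv => ⟨huv.ne, ConnectedComponent.sound huv.reachable⟩,
    fun huv => isDisjointUnionOfCliques_iff.1 h u v (ConnectedComponent.exact huv.2) huv.1⟩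

theorem exists_induced_path_of_not_isDisjointUnionOfCliques {V : Type*} {G : SimpleGraph V}
    (h : ¬ G.IsDisjointUnionOfCliques) :
    ∃ u v w, G.Adj u v ∧ G.Adj v w ∧ u ≠ w ∧ ¬ G.Adj u w := by
  by_contra! hcon
  refine h (isDisjointUnionOfCliques_iff.2 fun u v ⟨p⟩ => ?_)
  induction p with
  | nil => exact fun hne => (hne rfl).elim
  | @cons a b c hab q ih =>
    intro hac
    by_cases hbc : b = c
    · exact hbc ▸ hab
    · exact hcon a b c hab (ih ⟨q⟩ hbc) hac

/-- For an edge `uv` and a vertex `w` of another component, `u, w, v` is a path in the complement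
whose ends are not adjacent there. -/
theorem IsDisjointUnionOfCliques.not_compl {V : Type*} {G : SimpleGraph V}
    (h : G.IsDisjointUnionOfCliques) (hcomplete : G ≠ ⊤) (hempty : G ≠ ⊥) :
    ¬ Gᶜ.IsDisjointUnionOfCliques := by
  intro hc
  obtain ⟨u, v, huv⟩ := ne_bot_iff_exists_adj.1 hempty
  obtain ⟨w, hw⟩ : ∃ w, G.connectedComponentMk w ≠ G.connectedComponentMk u := by
    by_contra! hall
    refine hcomplete ?_
    ext a b
    rw [h.adj_iff, hall a, hall b, top_adj, and_iff_left rfl]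
  have hwv : G.connectedComponentMk w ≠ G.connectedComponentMk v :=
    fun heq => hw (heq.trans (h.adj_iff.1 huv).2.symm)
  have h1 : Gᶜ.Adj u w :=
    (compl_adj _ _ _).2 ⟨fun heq => hw (by rw [heq]), fun hadj => hw (h.adj_iff.1 hadj).2.symm⟩
  have h2 : Gᶜ.Adj w v :=
    (compl_adj _ _ _).2 ⟨fun heq => hwv (by rw [heq]), fun hadj => hwv (h.adj_iff.1 hadj).2⟩
  exact ((compl_adj _ _ _).1 (isDisjointUnionOfCliques_iff.1 hc u v
    (h1.reachable.trans h2.reachable) huv.ne)).2 huv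

variable {V : Type*} [Fintype V] {G : SimpleGraph V} {t : ℝ}

open scoped Classical in
/-- The sum of the coordinates of `x` over a connected component. -/
noncomputable def componentSum (G : SimpleGraph V) (x : V → ℝ) (c : G.ConnectedComponent) : ℝ :=
  ∑ v with G.connectedComponentMk v = c, x v

open scoped Classical in
theorem card_filter_connectedComponentMk (c : G.ConnectedComponent) :
    (Finset.univ.filter fun v => G.connectedComponentMk v = c).card = c.supp.ncard := by
  rw [← Set.ncard_coe_finset]
  congr 1
  ext v
  simp

theorem ConnectedComponent.ncard_supp_pos (c : G.ConnectedComponent) : 0 < c.supp.ncard :=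
  (Set.ncard_pos (Set.toFinite _)).2 c.nonempty_supp

theorem sum_componentSum [Fintype G.ConnectedComponent] (x : V → ℝ) :
    ∑ c, G.componentSum x c = ∑ v, x v := by
  classical
  exact Finset.sum_fiberwise _ _ _

open scoped Classical in
theorem componentSum_sq_le (x : V → ℝ) (c : G.ConnectedComponent) :
    G.componentSum x c ^ 2 ≤ c.supp.ncard * G.componentSum (fun v => x v ^ 2) c := by
  rw [← card_filter_connectedComponentMk]
  exact sq_sum_le_card_mul_sum_sq

theorem componentSum_eq_of_eqOn {x : V → ℝ} {c : G.ConnectedComponent} {a : ℝ}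
    (h : ∀ v, G.connectedComponentMk v = c → x v = a) :
    G.componentSum x c = c.supp.ncard * a := by
  classical
  rw [← card_filter_connectedComponentMk, componentSum,
    Finset.sum_congr rfl fun v hv => h v (Finset.mem_filter.1 hv).2]
  simp

/-- The set of connected components of maximal size. -/
def largestComponents (G : SimpleGraph V) : Set G.ConnectedComponent :=
  {c | ∀ c' : G.ConnectedComponent, c'.supp.ncard ≤ c.supp.ncard}

theorem largestComponents_nonempty [Nonempty V] (G : SimpleGraph V) :
    G.largestComponents.Nonempty :=
  Finite.exists_max fun c : G.ConnectedComponent => c.supp.ncard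

open scoped Classical in
/-- The vectors which are constant on each component and vanish off the largest components. -/
noncomputable def largestComponentsExtend (G : SimpleGraph V) :
    (G.largestComponents → ℝ) →ₗ[ℝ] V → ℝ where
  toFun y v := if h : G.connectedComponentMk v ∈ G.largestComponents then y ⟨_, h⟩ else 0
  map_add' y z := by
    ext v
    by_cases h : G.connectedComponentMk v ∈ G.largestComponents <;> simp [h]
  map_smul' a y := by
    ext v
    by_cases h : G.connectedComponentMk v ∈ G.largestComponents <;> simp [h]

theorem largestComponentsExtend_injective {V : Type*} (G : SimpleGraph V) :
    Function.Injective G.largestComponentsExtend := by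
  rintro y z hyz
  ext ⟨c, hc⟩
  obtain ⟨v, rfl⟩ := c.exists_rep
  have hv : G.connectedComponentMk v ∈ G.largestComponents := hc
  have := congrFun hyz v
  simp only [largestComponentsExtend, LinearMap.coe_mk, AddHom.coe_mk, dif_pos hv] at this
  exact this

open scoped Classical in
theorem componentSum_largestComponentsExtend (y : G.largestComponents → ℝ)
    {c₀ : G.ConnectedComponent} (hc₀ : c₀ ∈ G.largestComponents) (c : G.ConnectedComponent) :
    G.componentSum (G.largestComponentsExtend y) c =
      c₀.supp.ncard * if h : c ∈ G.largestComponents then y ⟨c, h⟩ else 0 := by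
  rw [componentSum_eq_of_eqOn (a := if h : c ∈ G.largestComponents then y ⟨c, h⟩ else 0)
    (fun v hv => by subst hv; rfl)]
  by_cases h : c ∈ G.largestComponents
  · rw [le_antisymm (hc₀ c) (h c₀)]
  · simp [h]

variable [DecidableRel G.Adj]

/-- The vector `(1, -2, 1)` on an induced path with three vertices has form `6t - 8`, so in fact `t
≥ 4/3`. -/
theorem CenteredNonneg.one_lt (ht : G.CenteredNonneg t) (h : ¬ G.IsDisjointUnionOfCliques) :
    1 < t := by
  classical
  obtain ⟨u, v, w, huv, hvw, huw, hnadj⟩ := exists_induced_path_of_not_isDisjointUnionOfCliques h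
  have hx := ht (Pi.single u 1 - (2 : ℝ) • Pi.single v 1 + Pi.single w 1)
    (by simp [Finset.sum_add_distrib, ← Finset.mul_sum]; norm_num)
  simp only [shiftedForm, mulVec_add, mulVec_sub, mulVec_smul, add_dotProduct, sub_dotProduct,
    dotProduct_add, dotProduct_sub, smul_dotProduct, dotProduct_smul, single_one_dotProduct,
    mulVec_single_one, col_apply, adjMatrix_apply, huv, huv.symm, hvw, hvw.symm, hnadj,
    G.adj_comm w u, SimpleGraph.irrefl, Pi.single_eq_same, Pi.single_eq_of_ne huv.ne,
    Pi.single_eq_of_ne huv.ne.symm, Pi.single_eq_of_ne hvw.ne, Pi.single_eq_of_ne hvw.ne.symm,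
    Pi.single_eq_of_ne huw, Pi.single_eq_of_ne huw.symm, if_true, if_false, smul_eq_mul] at hx
  linarith

theorem IsDisjointUnionOfCliques.mulVec_add (h : G.IsDisjointUnionOfCliques) (x : V → ℝ) (v : V) :
    (G.adjMatrix ℝ *ᵥ x) v + x v = G.componentSum x (G.connectedComponentMk v) := by
  classical
  rw [componentSum, ← Finset.sum_erase_add _ _ (a := v) (by simp), adjMatrix_mulVec_apply]
  congr 1
  refine Finset.sum_congr ?_ fun _ _ => rfl
  ext u
  simp [h.adj_iff, eq_comm]

theorem IsDisjointUnionOfCliques.shiftedForm_one [Fintype G.ConnectedComponent]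
    (h : G.IsDisjointUnionOfCliques) (x : V → ℝ) :
    G.shiftedForm 1 x = ∑ c, G.componentSum x c ^ 2 := by
  classical
  have h1 : G.shiftedForm 1 x = ∑ v, x v * G.componentSum x (G.connectedComponentMk v) := by
    rw [shiftedForm, one_mul, ← dotProduct_add]
    exact Finset.sum_congr rfl fun v _ => by rw [Pi.add_apply, h.mulVec_add]
  rw [h1, ← sum_componentSum (G := G)]
  refine Finset.sum_congr rfl fun c _ => ?_
  rw [sq]
  nth_rw 2 [componentSum]
  rw [componentSum, Finset.sum_mul]
  refine Finset.sum_congr rfl fun v hv => ?_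
  rw [(Finset.mem_filter.1 hv).2, componentSum]

theorem IsDisjointUnionOfCliques.centeredNonneg_one (h : G.IsDisjointUnionOfCliques) :
    G.CenteredNonneg 1 := by
  classical
  intro x _
  rw [h.shiftedForm_one]
  positivity

theorem IsDisjointUnionOfCliques.shiftedForm_compl [Fintype G.ConnectedComponent] [DecidableRel Gᶜ.Adj]
    (h : G.IsDisjointUnionOfCliques) {x : V → ℝ} (hx : ∑ v, x v = 0) :
    Gᶜ.shiftedForm t x = t * (x ⬝ᵥ x) - ∑ c, G.componentSum x c ^ 2 := by
  classical
  rw [← h.shiftedForm_one, shiftedForm, shiftedForm]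
  have h1 : Gᶜ.adjMatrix ℝ *ᵥ x = -x - G.adjMatrix ℝ *ᵥ x := by
    convert adjMatrix_compl_mulVec hx
  rw [h1, dotProduct_sub, dotProduct_neg]
  ring

theorem IsDisjointUnionOfCliques.mem_centeredKernel_compl [DecidableRel Gᶜ.Adj]
    (h : G.IsDisjointUnionOfCliques) {x : V → ℝ} :
    x ∈ Gᶜ.centeredKernel t ↔ ∑ v, x v = 0 ∧
      ∀ u v, t * x u - G.componentSum x (G.connectedComponentMk u) =
        t * x v - G.componentSum x (G.connectedComponentMk v) := by
  classical
  rw [mem_centeredKernel]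
  refine and_congr_right fun hx => ?_
  have h1 : Gᶜ.adjMatrix ℝ *ᵥ x = -x - G.adjMatrix ℝ *ᵥ x := by
    convert adjMatrix_compl_mulVec hx
  refine forall_congr' fun u => forall_congr' fun v => ?_
  rw [h1, ← h.mulVec_add, ← h.mulVec_add]
  simp only [Pi.sub_apply, Pi.neg_apply]
  constructor <;> intro h2 <;> linarith

/-- Cauchy–Schwarz on each component, with its size bounded by the largest one. -/
theorem IsDisjointUnionOfCliques.centeredNonneg_compl [DecidableRel Gᶜ.Adj]
    (h : G.IsDisjointUnionOfCliques) {c₀ : G.ConnectedComponent} (hc₀ : c₀ ∈ G.largestComponents) :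
    Gᶜ.CenteredNonneg c₀.supp.ncard := by
  classical
  intro x hx
  have h1 : x ⬝ᵥ x = ∑ c, G.componentSum (fun v => x v ^ 2) c := by
    rw [sum_componentSum]; simp [dotProduct, sq]
  rw [h.shiftedForm_compl hx, h1, Finset.mul_sum, sub_nonneg]
  refine Finset.sum_le_sum fun c _ => (componentSum_sq_le x c).trans ?_
  refine mul_le_mul_of_nonneg_right (by exact_mod_cast hc₀ c) (Finset.sum_nonneg fun v _ => ?_)
  positivity

open scoped Classical in
theorem sum_largestComponentsExtend (y : G.largestComponents → ℝ)
    {c₀ : G.ConnectedComponent} (hc₀ : c₀ ∈ G.largestComponents) :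
    ∑ v, G.largestComponentsExtend y v = c₀.supp.ncard * ∑ c, y c := by
  rw [← sum_componentSum (G := G), Finset.sum_congr rfl fun c _ =>
    componentSum_largestComponentsExtend y hc₀ c, ← Finset.mul_sum, Finset.sum_dite]
  simp only [Finset.sum_const_zero, add_zero]
  congr 1
  refine Finset.sum_bij (fun c _ => ⟨c.1, (Finset.mem_filter.1 c.2).2⟩) (by simp) ?_ ?_ ?_
  · rintro ⟨c, _⟩ _ ⟨d, _⟩ _ hcd
    simpa using hcd
  · rintro ⟨c, hc⟩ _
    exact ⟨⟨c, by simpa using hc⟩, by simp, rfl⟩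
  · simp

-- With `N` the largest size and `S` the component sums, kernel vectors satisfy `N x v = S c + k` on
-- each component `c`. Summing over `c₀` gives `k = 0`; summing over `c` gives `N S c = |c| S c`, so
-- `x` vanishes off the largest components.
open scoped Classical in
theorem IsDisjointUnionOfCliques.centeredKernel_compl_eq [DecidableRel Gᶜ.Adj]
    (h : G.IsDisjointUnionOfCliques) {c₀ : G.ConnectedComponent} (hc₀ : c₀ ∈ G.largestComponents) :
    Gᶜ.centeredKernel c₀.supp.ncard =
      (Fintype.linearCombination ℝ (fun _ : G.largestComponents => (1 : ℝ))).ker.map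
        G.largestComponentsExtend := by
  have hN : (c₀.supp.ncard : ℝ) ≠ 0 := by exact_mod_cast c₀.ncard_supp_pos.ne'
  ext x
  rw [h.mem_centeredKernel_compl, Submodule.mem_map]
  constructor
  · rintro ⟨hx, hconst⟩
    obtain ⟨w, rfl⟩ := c₀.exists_rep
    set c₀ := G.connectedComponentMk w with hc
    change c₀ ∈ _ at hc₀
    change (c₀.supp.ncard : ℝ) ≠ 0 at hN
    change ∀ u v, (c₀.supp.ncard : ℝ) * x u - _ = (c₀.supp.ncard : ℝ) * x v - _ at hconst
    set k := (c₀.supp.ncard : ℝ) * x w - G.componentSum x c₀ with hk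
    have hxk : ∀ v, (c₀.supp.ncard : ℝ) * x v =
        G.componentSum x (G.connectedComponentMk v) + k := by
      intro v; linarith [hconst v w]
    have hsum : ∀ c : G.ConnectedComponent, (c₀.supp.ncard : ℝ) * G.componentSum x c =
        c.supp.ncard * (G.componentSum x c + k) := by
      intro c
      rw [← componentSum_eq_of_eqOn (x := fun v => (c₀.supp.ncard : ℝ) * x v) (c := c)
        fun v hv => by rw [hxk, hv]]
      simp [componentSum, Finset.mul_sum]
    have hk0 : k = 0 := by
      have := hsum c₀
      rw [mul_add, left_eq_add, mul_eq_zero] at this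
      exact this.resolve_left hN
    simp only [hk0, add_zero] at hxk hsum
    have hext : G.largestComponentsExtend (fun c => G.componentSum x c / c₀.supp.ncard) = x := by
      ext v
      change (if _ : _ then _ else _) = _
      split_ifs with hv
      · rw [← hxk]; field_simp
      · have hne : (c₀.supp.ncard : ℝ) ≠ (G.connectedComponentMk v).supp.ncard := by
          intro heq
          refine hv fun c' => (hc₀ c').trans ?_
          exact_mod_cast heq.le
        have h0 : G.componentSum x (G.connectedComponentMk v) = 0 := by
          by_contra h0
          exact hne (mul_right_cancel₀ h0 (hsum _))
        have := hxk v
        rw [h0, mul_eq_zero] at this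
        exact (this.resolve_left hN).symm
    refine ⟨_, ?_, hext⟩
    have h2 := sum_largestComponentsExtend (fun c => G.componentSum x c / c₀.supp.ncard) hc₀
    rw [hext, hx, zero_eq_mul] at h2
    simpa [Fintype.linearCombination_apply] using h2.resolve_left hN
  · rintro ⟨y, hy, rfl⟩
    have hy' : ∑ c, y c = 0 := by
      simpa [Fintype.linearCombination_apply] using hy
    have hval : ∀ v, (c₀.supp.ncard : ℝ) * G.largestComponentsExtend y v -
        G.componentSum (G.largestComponentsExtend y) (G.connectedComponentMk v) = 0 := by
      intro v
      rw [componentSum_largestComponentsExtend y hc₀, sub_eq_zero]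
      rfl
    exact ⟨by rw [sum_largestComponentsExtend y hc₀, hy', mul_zero], fun u v => by
      rw [hval, hval]⟩

theorem IsDisjointUnionOfCliques.finrank_centeredKernel_compl [DecidableRel Gᶜ.Adj]
    (h : G.IsDisjointUnionOfCliques) {c₀ : G.ConnectedComponent} (hc₀ : c₀ ∈ G.largestComponents) :
    Module.finrank ℝ (Gᶜ.centeredKernel c₀.supp.ncard) + 1 = G.numLargestComponents := by
  classical
  rw [h.centeredKernel_compl_eq hc₀,
    ← (Submodule.equivMapOfInjective _ G.largestComponentsExtend_injective _).finrank_eq]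
  set φ := Fintype.linearCombination ℝ (fun _ : G.largestComponents => (1 : ℝ)) with hφ
  have hsurj : φ.range = ⊤ := by
    refine LinearMap.range_eq_top.2 fun a => ⟨Pi.single ⟨c₀, hc₀⟩ a, ?_⟩
    simp [hφ]
  have h1 := φ.finrank_range_add_finrank_ker
  rw [hsurj, finrank_top, Module.finrank_self, Module.finrank_fintype_fun_eq_card] at h1
  rw [add_comm, h1, ← Nat.card_eq_fintype_card]
  rfl

/-- The sum over the unique largest component `c₀` is injective on the kernel. A kernel vector with
this sum zero vanishes on `c₀`; if it were nonzero on another component `c`, then `t = |c|`, which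
is too small for nonnegativity. -/
theorem IsDisjointUnionOfCliques.finrank_le_one_of_subsingleton [DecidableRel Gᶜ.Adj]
    (h : G.IsDisjointUnionOfCliques) (hr : G.largestComponents.Subsingleton)
    {c₀ : G.ConnectedComponent} (hc₀ : c₀ ∈ G.largestComponents) (ht0 : 0 < t)
    (ht : Gᶜ.CenteredNonneg t) : Module.finrank ℝ (Gᶜ.centeredKernel t) ≤ 1 := by
  classical
  let φ : (V → ℝ) →ₗ[ℝ] ℝ :=
    Fintype.linearCombination ℝ (fun v => if G.connectedComponentMk v = c₀ then (1 : ℝ) else 0)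
  have hφ : ∀ x, φ x = G.componentSum x c₀ := by
    intro x
    simp [φ, Fintype.linearCombination_apply, componentSum, Finset.sum_filter]
  suffices hinj : Function.Injective (φ.domRestrict (Gᶜ.centeredKernel t)) by
    simpa using LinearMap.finrank_le_finrank_of_injective hinj
  rw [← LinearMap.ker_eq_bot, LinearMap.ker_eq_bot']
  rintro ⟨x, hx⟩ hx0
  have hs0 : G.componentSum x c₀ = 0 := by rw [← hφ]; exact hx0
  obtain ⟨hsum, hconst⟩ := h.mem_centeredKernel_compl.1 hx
  have hbase : ∀ v, G.connectedComponentMk v = c₀ → x v = 0 := by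
    intro v hv
    have hcst : ∀ u, G.connectedComponentMk u = c₀ → x u = x v := by
      intro u hu
      have := hconst u v
      rw [hu, hv] at this
      exact mul_left_cancel₀ ht0.ne' (by linarith)
    rw [componentSum_eq_of_eqOn hcst, mul_eq_zero] at hs0
    exact hs0.resolve_left (by exact_mod_cast c₀.ncard_supp_pos.ne')
  obtain ⟨w, hw⟩ := c₀.exists_rep
  have hx1 : ∀ v, t * x v = G.componentSum x (G.connectedComponentMk v) := by
    intro v
    have := hconst v w
    rw [hbase w hw, show G.connectedComponentMk w = c₀ from hw, hs0] at this
    linarith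
  rw [Submodule.mk_eq_zero]
  by_contra hne
  obtain ⟨v, hv⟩ := Function.ne_iff.1 hne
  simp only [Pi.zero_apply] at hv
  set c := G.connectedComponentMk v with hc
  have hcne : c ≠ c₀ := fun heq => hv (hbase v heq)
  have htc : t = c.supp.ncard := by
    have h1 : G.componentSum (fun u => t * x u) c = c.supp.ncard * G.componentSum x c :=
      componentSum_eq_of_eqOn fun u hu => by rw [hx1, hu]
    have h2 : G.componentSum (fun u => t * x u) c = t * G.componentSum x c := by
      simp [componentSum, Finset.mul_sum]
    refine mul_right_cancel₀ (b := G.componentSum x c) ?_ (h2.symm.trans h1)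
    rw [hc, ← hx1]
    exact mul_ne_zero ht0.ne' hv
  have hlt : c.supp.ncard < c₀.supp.ncard := by
    refine lt_of_le_of_ne (hc₀ c) fun heq => hcne (hr (fun c' => ?_) hc₀)
    rw [heq]; exact hc₀ c'
  have hpos : (0 : ℝ) < c.supp.ncard := by exact_mod_cast c.ncard_supp_pos
  have hpos₀ : (0 : ℝ) < c₀.supp.ncard := by exact_mod_cast c₀.ncard_supp_pos
  -- Difference of the uniform averages on `c₀` and `c`: its form is `t(1/|c₀| + 1/|c|) - 2`, which
  -- is negative for `t = |c| < |c₀|`.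
  let a : G.ConnectedComponent → ℝ :=
    Pi.single c₀ (c₀.supp.ncard : ℝ)⁻¹ - Pi.single c (c.supp.ncard : ℝ)⁻¹
  have hsa : ∀ b : G.ConnectedComponent → ℝ, ∀ d,
      G.componentSum (fun u => b (G.connectedComponentMk u)) d = d.supp.ncard * b d :=
    fun b d => componentSum_eq_of_eqOn fun u hu => by rw [hu]
  have hz : ∑ u, a (G.connectedComponentMk u) = 0 := by
    rw [← sum_componentSum (G := G), Finset.sum_congr rfl fun d _ => hsa a d]
    simp [a, mul_sub, Finset.sum_sub_distrib, Pi.single_apply, hpos.ne', hpos₀.ne']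
  have hform := ht _ hz
  have hsq : (∑ u, a (G.connectedComponentMk u) * a (G.connectedComponentMk u)) =
      (c₀.supp.ncard : ℝ)⁻¹ + (c.supp.ncard : ℝ)⁻¹ := by
    rw [← sum_componentSum (G := G), Finset.sum_congr rfl fun d _ => hsa (fun e => a e * a e) d,
      ← Finset.sum_subset (Finset.subset_univ {c₀, c}), Finset.sum_pair hcne.symm]
    · simp [a, hcne, hcne.symm]
      field_simp
    · intro d _ hd
      simp only [Finset.mem_insert, Finset.mem_singleton, not_or] at hd
      simp [a, hd.1, hd.2]
  have hsq2 : ∑ d, G.componentSum (fun u => a (G.connectedComponentMk u)) d ^ 2 = 2 := by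
    rw [Finset.sum_congr rfl fun d _ => by rw [hsa a d],
      ← Finset.sum_subset (Finset.subset_univ {c₀, c}), Finset.sum_pair hcne.symm]
    · simp [a, hcne, hcne.symm, hpos.ne', hpos₀.ne']
      norm_num
    · intro d _ hd
      simp only [Finset.mem_insert, Finset.mem_singleton, not_or] at hd
      simp [a, hd.1, hd.2]
  rw [h.shiftedForm_compl hz, dotProduct, hsq, hsq2, htc, mul_add, mul_inv_cancel₀ hpos.ne'] at hform
  have : (c.supp.ncard : ℝ) * (c₀.supp.ncard : ℝ)⁻¹ < 1 := by
    rw [← div_eq_mul_inv, div_lt_one hpos₀]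
    exact_mod_cast hlt
  linarith

theorem IsDisjointUnionOfCliques.finrank_add_one_eq_max [Nonempty V] [DecidableRel Gᶜ.Adj]
    (h : G.IsDisjointUnionOfCliques) (ht0 : 0 < t) (ht : Gᶜ.IsCritical t) :
    Module.finrank ℝ (Gᶜ.centeredKernel t) + 1 = max G.numLargestComponents 2 := by
  obtain ⟨c₀, hc₀⟩ := G.largestComponents_nonempty
  have h1 := h.finrank_centeredKernel_compl hc₀
  have h2 := ht.finrank_pos
  by_cases hr : 2 ≤ G.numLargestComponents
  · have hcrit : Gᶜ.IsCritical c₀.supp.ncard :=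
      ⟨h.centeredNonneg_compl hc₀, fun hbot => by rw [hbot, finrank_bot] at h1; omega⟩
    rw [ht.eq hcrit, h1, max_eq_left hr]
  · have hsub : G.largestComponents.Subsingleton := by
      rw [← Set.ncard_le_one_iff_subsingleton]
      change G.numLargestComponents ≤ 1
      omega
    have := h.finrank_le_one_of_subsingleton hsub hc₀ ht0 ht.1
    omega

theorem IsDisjointUnionOfCliques.euclideanRep_eq (h : G.IsDisjointUnionOfCliques)
    (hcomplete : G ≠ ⊤) (hempty : G ≠ ⊥) :
    (G.euclideanRep : ℤ) = (Fintype.card V : ℤ) - max (G.numLargestComponents : ℤ) 2 := by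
  classical
  obtain ⟨u, v, huv⟩ := ne_bot_iff_exists_adj.1 hempty
  have : Nontrivial V := ⟨u, v, huv.ne⟩
  obtain ⟨s, hs⟩ := exists_isCritical G
  obtain ⟨t, ht⟩ := exists_isCritical Gᶜ
  have ht1 : 1 < t := ht.1.one_lt (h.not_compl hcomplete hempty)
  have h1 := euclideanRep_add_eq_of_le_one hs ht (hs.le_of_centeredNonneg h.centeredNonneg_one) ht1
  have h2 := h.finrank_add_one_eq_max (by linarith) ht
  omega

end DisjointUnionOfCliques

/-! ### Comparison with adjacency eigenspaces -/

section AdjacencyEigenvalues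

variable {V : Type*} [Fintype V] [DecidableEq V] {G : SimpleGraph V} [DecidableRel G.Adj] {t μ : ℝ}
  {x : V → ℝ}

theorem mem_eigenspace_adjMatrix :
    x ∈ Module.End.eigenspace (Matrix.toLin' (G.adjMatrix ℝ)) μ ↔
      G.adjMatrix ℝ *ᵥ x = μ • x := by
  rw [Module.End.mem_eigenspace_iff, Matrix.toLin'_apply]

theorem mem_adjEigenvalues_of_mulVec_eq (hx : x ≠ 0) (h : G.adjMatrix ℝ *ᵥ x = μ • x) :
    μ ∈ G.adjEigenvalues :=
  Module.End.hasEigenvalue_of_hasEigenvector ⟨mem_eigenspace_adjMatrix.2 h, hx⟩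

theorem exists_mulVec_eq_of_mem_adjEigenvalues (h : μ ∈ G.adjEigenvalues) :
    ∃ x, x ≠ 0 ∧ G.adjMatrix ℝ *ᵥ x = μ • x := by
  obtain ⟨x, hx⟩ := Module.End.HasEigenvalue.exists_hasEigenvector h
  exact ⟨x, hx.2, mem_eigenspace_adjMatrix.1 hx.1⟩

theorem posSemidef_adjMatrix_sub_smallestEigenvalue [Nonempty V] :
    (G.adjMatrix ℝ - G.smallestEigenvalue • (1 : Matrix V V ℝ)).PosSemidef := by
  have hherm : (G.adjMatrix ℝ - G.smallestEigenvalue • (1 : Matrix V V ℝ)).IsHermitian := by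
    rw [IsHermitian, conjTranspose_eq_transpose_of_trivial]
    simp
  rw [hherm.posSemidef_iff_eigenvalues_nonneg]
  intro i
  have h := hherm.mulVec_eigenvectorBasis i
  rw [sub_mulVec, smul_mulVec, one_mulVec, sub_eq_iff_eq_add, ← add_smul] at h
  have hne : (hherm.eigenvectorBasis i).ofLp ≠ 0 := by
    intro h0
    exact hherm.eigenvectorBasis.orthonormal.ne_zero i (by ext v; exact congrFun h0 v)
  have := G.isLeast_smallestEigenvalue.2 (mem_adjEigenvalues_of_mulVec_eq hne h)
  simp only [Pi.zero_apply]
  linarith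

theorem dotProduct_adjMatrix_sub_smallestEigenvalue (x : V → ℝ) :
    star x ⬝ᵥ ((G.adjMatrix ℝ - G.smallestEigenvalue • (1 : Matrix V V ℝ)) *ᵥ x) =
      G.shiftedForm (-G.smallestEigenvalue) x := by
  rw [sub_mulVec, smul_mulVec, one_mulVec, star_trivial, dotProduct_sub, dotProduct_smul,
    shiftedForm, smul_eq_mul]
  ring

theorem shiftedForm_neg_smallestEigenvalue_nonneg [Nonempty V] (x : V → ℝ) :
    0 ≤ G.shiftedForm (-G.smallestEigenvalue) x := by
  rw [← dotProduct_adjMatrix_sub_smallestEigenvalue]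
  exact posSemidef_adjMatrix_sub_smallestEigenvalue.dotProduct_mulVec_nonneg x

theorem mulVec_eq_of_shiftedForm_eq_zero [Nonempty V]
    (h : G.shiftedForm (-G.smallestEigenvalue) x = 0) :
    G.adjMatrix ℝ *ᵥ x = G.smallestEigenvalue • x := by
  rw [← dotProduct_adjMatrix_sub_smallestEigenvalue,
    posSemidef_adjMatrix_sub_smallestEigenvalue.dotProduct_mulVec_zero_iff, sub_mulVec, smul_mulVec,
    one_mulVec, sub_eq_zero] at h
  exact h

theorem isCritical_neg_smallestEigenvalue [Nonempty V] (hx0 : x ≠ 0) (hx : ∑ v, x v = 0)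
    (h : G.adjMatrix ℝ *ᵥ x = G.smallestEigenvalue • x) :
    G.IsCritical (-G.smallestEigenvalue) :=
  ⟨fun y _ => shiftedForm_neg_smallestEigenvalue_nonneg y, fun hbot => hx0 (by
    simpa [hbot] using mem_centeredKernel_of_mulVec_eq hx h)⟩

/-- Applied to the coordinate sum on an eigenspace, and to the common value of `(A + tI)x` on a
centered kernel. -/
theorem finrank_le_finrank_inf_ker_add_one {M : Type*} [AddCommGroup M] [Module ℝ M]
    [FiniteDimensional ℝ M] (E : Submodule ℝ M) (φ : M →ₗ[ℝ] ℝ) :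
    Module.finrank ℝ E ≤ Module.finrank ℝ (E ⊓ φ.ker : Submodule ℝ M) + 1 := by
  have h1 := Submodule.finrank_sup_add_finrank_inf_eq E φ.ker
  have h2 := φ.finrank_range_add_finrank_ker
  have h3 := Submodule.finrank_le φ.range
  have h4 := Submodule.finrank_le (E ⊔ φ.ker)
  rw [Module.finrank_self] at h3
  omega

/-- At this parameter the form is nonnegative on all vectors, so its null vectors are genuine
eigenvectors. -/
theorem centeredKernel_neg_smallestEigenvalue_le [Nonempty V] :
    G.centeredKernel (-G.smallestEigenvalue) ≤
      Module.End.eigenspace (Matrix.toLin' (G.adjMatrix ℝ)) G.smallestEigenvalue := fun _ hx =>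
  mem_eigenspace_adjMatrix.2 (mulVec_eq_of_shiftedForm_eq_zero (shiftedForm_eq_zero_of_mem hx))

theorem IsCritical.smallestMult_le [Nonempty V] (ht : G.IsCritical t) :
    G.smallestMult ≤ Module.finrank ℝ (G.centeredKernel t) + 1 := by
  set E := Module.End.eigenspace (Matrix.toLin' (G.adjMatrix ℝ)) G.smallestEigenvalue with hE
  let σ : (V → ℝ) →ₗ[ℝ] ℝ := Fintype.linearCombination ℝ (fun _ => (1 : ℝ))
  have hσ : ∀ x, σ x = ∑ v, x v := fun x => by simp [σ, Fintype.linearCombination_apply]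
  have h1 : G.smallestMult ≤ _ := finrank_le_finrank_inf_ker_add_one E σ
  have hle : E ⊓ σ.ker ≤ G.centeredKernel (-G.smallestEigenvalue) := by
    rintro x ⟨hx, hx'⟩
    exact mem_centeredKernel_of_mulVec_eq ((hσ x).symm.trans hx') (mem_eigenspace_adjMatrix.1 hx)
  have h2 := Submodule.finrank_mono hle
  by_cases hbot : E ⊓ σ.ker = ⊥
  · rw [hbot, finrank_bot] at h1
    omega
  · have hcrit : G.IsCritical (-G.smallestEigenvalue) :=
      ⟨fun y _ => shiftedForm_neg_smallestEigenvalue_nonneg y,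
        fun h => hbot (le_bot_iff.1 (hle.trans h.le))⟩
    rw [ht.eq hcrit]
    omega

/-- One half of Cauchy interlacing: the span of eigenvectors for the two smallest eigenvalues
contains a nonzero sum-zero vector, whose Rayleigh quotient is at most the second eigenvalue. -/
theorem IsCritical.neg_le_secondSmallestEigenvalue [Nonempty V] (hG : G ≠ ⊥)
    (ht : G.IsCritical t) : -t ≤ G.secondSmallestEigenvalue := by
  have hleast := G.isLeast_secondSmallestEigenvalue hG
  have hlt : G.smallestEigenvalue < G.secondSmallestEigenvalue :=
    lt_of_le_of_ne (G.isLeast_smallestEigenvalue.2 hleast.1.1) (Ne.symm hleast.1.2)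
  obtain ⟨x, hx0, hx⟩ := exists_mulVec_eq_of_mem_adjEigenvalues G.isLeast_smallestEigenvalue.1
  obtain ⟨y, hy0, hy⟩ := exists_mulVec_eq_of_mem_adjEigenvalues hleast.1.1
  by_cases hsx : ∑ v, x v = 0
  · rw [ht.eq (isCritical_neg_smallestEigenvalue hx0 hsx hx), neg_neg]
    exact hlt.le
  set a := ∑ v, x v with ha
  set b := ∑ v, y v with hb
  set z := a • y + (-b) • x with hz
  have hzsum : ∑ v, z v = 0 := by
    simp only [hz, Pi.add_apply, Pi.smul_apply, smul_eq_mul, Finset.sum_add_distrib,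
      ← Finset.mul_sum, ← ha, ← hb]
    ring
  have hz0 : z ≠ 0 := by
    intro h0
    have h1 : a • y = b • x := by rw [← sub_eq_zero, ← h0, hz]; module
    have h2 : (a * (G.secondSmallestEigenvalue - G.smallestEigenvalue)) • y = 0 := by
      have h3 := congrArg (G.adjMatrix ℝ *ᵥ ·) h1
      simp only [mulVec_smul, hx, hy] at h3
      rw [smul_comm b, ← h1] at h3
      rw [mul_sub, sub_smul, sub_eq_zero, mul_smul, h3, smul_smul, mul_comm]
    exact (smul_ne_zero (mul_ne_zero hsx (sub_pos.2 hlt).ne') hy0) h2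
  have hform : G.shiftedForm (-G.secondSmallestEigenvalue) z ≤ 0 := by
    have h1 : G.shiftedForm (-G.secondSmallestEigenvalue) (a • y) = 0 := by
      simp only [shiftedForm, mulVec_smul, hy, dotProduct_smul, smul_dotProduct, smul_eq_mul]
      ring
    have h2 : G.adjMatrix ℝ *ᵥ (a • y) + (-G.secondSmallestEigenvalue) • (a • y) = 0 := by
      rw [mulVec_smul, hy]; module
    have h3 : G.shiftedForm (-G.secondSmallestEigenvalue) x ≤ 0 := by
      simp only [shiftedForm, hx, dotProduct_smul, smul_eq_mul]
      nlinarith [dotProduct_self_pos hx0]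
    rw [hz, shiftedForm_add_smul, h1, h2, dotProduct_zero]
    nlinarith [sq_nonneg b]
  have hnn := ht.1 z hzsum
  rw [shiftedForm_eq_add t (-G.secondSmallestEigenvalue)] at hnn
  nlinarith [dotProduct_self_pos hz0]

/-- If `-t` is not the smallest eigenvalue, the kernel vectors with `(A + tI)x = 0` have codimension
at most one and are eigenvectors for `-t`. By interlacing such an eigenvalue can only be the second
smallest. -/
theorem IsCritical.finrank_le_max [Nonempty V] (hG : G ≠ ⊥) (ht : G.IsCritical t) :
    Module.finrank ℝ (G.centeredKernel t) ≤ max G.smallestMult (G.secondSmallestMult + 1) := by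
  by_cases ht1 : t = -G.smallestEigenvalue
  · subst ht1
    exact le_max_of_le_left (Submodule.finrank_mono centeredKernel_neg_smallestEigenvalue_le)
  refine le_max_of_le_right ?_
  obtain ⟨w⟩ := ‹Nonempty V›
  let τ : (V → ℝ) →ₗ[ℝ] ℝ :=
    LinearMap.proj w ∘ₗ (Matrix.toLin' (G.adjMatrix ℝ) + t • LinearMap.id)
  have hτ : ∀ x, τ x = (G.adjMatrix ℝ *ᵥ x) w + t * x w := fun x => by simp [τ]
  have h1 := finrank_le_finrank_inf_ker_add_one (G.centeredKernel t) τ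
  have hle : G.centeredKernel t ⊓ τ.ker ≤
      Module.End.eigenspace (Matrix.toLin' (G.adjMatrix ℝ)) (-t) := by
    rintro x ⟨hx, hx'⟩
    refine mem_eigenspace_adjMatrix.2 (funext fun v => ?_)
    have h2 := hx.2 v w
    rw [← hτ, LinearMap.mem_ker.1 hx'] at h2
    rw [Pi.smul_apply, smul_eq_mul]
    linarith
  by_cases hbot : G.centeredKernel t ⊓ τ.ker = ⊥
  · rw [hbot, finrank_bot] at h1
    omega
  · obtain ⟨x, hx, hx0⟩ := Submodule.exists_mem_ne_zero_of_ne_bot hbot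
    have hev : -t ∈ G.adjEigenvalues :=
      mem_adjEigenvalues_of_mulVec_eq hx0 (mem_eigenspace_adjMatrix.1 (hle hx))
    have : Nonempty V := ⟨w⟩
    have heq : -t = G.secondSmallestEigenvalue :=
      le_antisymm (ht.neg_le_secondSmallestEigenvalue hG)
        ((G.isLeast_secondSmallestEigenvalue hG).2 ⟨hev, fun h => ht1 (by
          rw [Set.mem_singleton_iff] at h; rw [← h, neg_neg])⟩)
    have h2 := Submodule.finrank_mono hle
    rw [heq] at h2
    change _ ≤ G.secondSmallestMult at h2
    omega

theorem smallestEigenvalue_neg [Nonempty V] (hG : G ≠ ⊥) : G.smallestEigenvalue < 0 := by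
  obtain ⟨u, v, huv⟩ := ne_bot_iff_exists_adj.1 hG
  have h := shiftedForm_neg_smallestEigenvalue_nonneg (G := G) (Pi.single u 1 - Pi.single v 1)
  simp only [shiftedForm, mulVec_sub, sub_dotProduct, dotProduct_sub, single_one_dotProduct,
    mulVec_single_one, col_apply, adjMatrix_apply, huv, huv.symm, SimpleGraph.irrefl,
    Pi.single_eq_same, Pi.single_eq_of_ne huv.ne, Pi.single_eq_of_ne huv.ne.symm, if_true,
    if_false] at h
  linarith

/-- The all-ones vector is an eigenvector for `k ≥ 0`, while the smallest eigenvalue is negative, so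
the lowest eigenspace is orthogonal to it and coincides with the kernel. -/
theorem IsCritical.finrank_eq_of_isRegularOfDegree [Nonempty V] (hG : G ≠ ⊥) (ht : G.IsCritical t)
    {k : ℕ} (hk : G.IsRegularOfDegree k) :
    Module.finrank ℝ (G.centeredKernel t) = G.smallestMult := by
  have hsum : ∀ x : V → ℝ, G.adjMatrix ℝ *ᵥ x = G.smallestEigenvalue • x → ∑ v, x v = 0 := by
    intro x hx
    have hone : G.adjMatrix ℝ *ᵥ (1 : V → ℝ) = (k : ℝ) • (1 : V → ℝ) := by
      ext v
      simp [adjMatrix_mulVec_apply, hk v]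
    have h := mulVec_adjMatrix_dotProduct_comm (G := G) 1 x
    rw [hx, hone, dotProduct_smul, dotProduct_smul, one_dotProduct, dotProduct_one, smul_eq_mul,
      smul_eq_mul] at h
    have hlt := (smallestEigenvalue_neg hG).trans_le (Nat.cast_nonneg (α := ℝ) k)
    by_contra h0
    exact hlt.ne (mul_right_cancel₀ h0 h)
  obtain ⟨x, hx0, hx⟩ := exists_mulVec_eq_of_mem_adjEigenvalues G.isLeast_smallestEigenvalue.1
  rw [ht.eq (isCritical_neg_smallestEigenvalue hx0 (hsum x hx) hx)]
  refine le_antisymm (Submodule.finrank_mono centeredKernel_neg_smallestEigenvalue_le)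
    (Submodule.finrank_mono fun y hy => ?_)
  have hy' := mem_eigenspace_adjMatrix.1 hy
  exact mem_centeredKernel_of_mulVec_eq (hsum y hy') hy'

end AdjacencyEigenvalues

end SimpleGraph

theorem mainTheorem2 {V : Type*} [Fintype V] [DecidableEq V] (G : SimpleGraph V)
    [DecidableRel G.Adj] (hcomplete : G ≠ ⊤) (hempty : G ≠ ⊥) :
    (G.IsDisjointUnionOfCliques →
      (G.euclideanRep : ℤ) = (Fintype.card V : ℤ) - max (G.numLargestComponents : ℤ) 2) ∧
    (Gᶜ.IsDisjointUnionOfCliques →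
      (G.euclideanRep : ℤ) = (Fintype.card V : ℤ) - max (Gᶜ.numLargestComponents : ℤ) 2) ∧
    (¬ G.IsDisjointUnionOfCliques → ¬ Gᶜ.IsDisjointUnionOfCliques →
      (Fintype.card V : ℤ) - 1 -
          max (max (G.smallestMult : ℤ) (Gᶜ.smallestMult : ℤ))
            (max ((G.secondSmallestMult : ℤ) + 1) ((Gᶜ.secondSmallestMult : ℤ) + 1))
        ≤ (G.euclideanRep : ℤ) ∧
      (G.euclideanRep : ℤ) ≤
        (Fintype.card V : ℤ) -
          max (max (G.smallestMult : ℤ) (Gᶜ.smallestMult : ℤ)) 2 ∧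
      ((∃ k : ℕ, G.IsRegularOfDegree k) →
        (G.euclideanRep : ℤ) =
          (Fintype.card V : ℤ) - 1 - max (G.smallestMult : ℤ) (Gᶜ.smallestMult : ℤ))) := by
  obtain ⟨u, v, huv⟩ := SimpleGraph.ne_bot_iff_exists_adj.1 hempty
  have : Nontrivial V := ⟨u, v, huv.ne⟩
  have hcompl : Gᶜ ≠ ⊥ := fun h => hcomplete (compl_eq_bot.1 h)
  refine ⟨fun h => h.euclideanRep_eq hcomplete hempty, fun h => ?_, fun h hc => ?_⟩
  · rw [← SimpleGraph.euclideanRep_compl]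
    exact h.euclideanRep_eq (fun htop => hempty (compl_eq_top.1 htop)) hcompl
  · obtain ⟨s, hs⟩ := SimpleGraph.exists_isCritical G
    obtain ⟨t, ht⟩ := SimpleGraph.exists_isCritical Gᶜ
    have hrep := SimpleGraph.euclideanRep_add_eq hs ht (hs.1.one_lt h) (ht.1.one_lt hc)
    refine ⟨?_, ?_, fun ⟨k, hk⟩ => ?_⟩
    · have h1 := hs.finrank_le_max hempty
      have h2 := ht.finrank_le_max hcompl
      omega
    · have h1 := hs.smallestMult_le
      have h2 := ht.smallestMult_le
      -- A critical kernel has dimension at least 1; this is the source of the `2` in the upper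
      -- bound.
      have h3 := hs.finrank_pos
      omega
    · rw [hs.finrank_eq_of_isRegularOfDegree hempty hk,
        ht.finrank_eq_of_isRegularOfDegree hcompl hk.compl] at hrep
      omega
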